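/- Let $K$ be a field, let $n\ge 2$ and $p=n-1$. Let $m_0,\dots,m_n$ be positive integers such that $m_0<m_1<\cdots<m_p$ is an arithmetic sequence, $m_n$ is arbitrary, $\gcd(m_0,\dots,m_n)=1$, and the numerical semigroup $\Gamma=\sum_{i=0}^{n}\mathbb N_0m_i$ is minimally generated by $m_0,\dots,m_n$. Put $\Gamma'=\sum_{i=0}^{p}\mathbb N_0m_i$ and $S=\{\gamma\in\Gamma : \gamma-m_0\notin\Gamma\}$. Let $P$ be the kernel of the $K$-algebra homomorphism $K[x_0,\dots,x_n]\to K[t]$, $x_i\mapsto t^{m_i}$. For an integer $t\ge 0$ write $t=q_tp+r_t$ with $q_t\in\mathbb Z$, $r_t\in\{1,\dots,p\}$, and put $g_t=q_tm_p+m_{r_t}$ (so $q_0=-1$, $r_0=p$, $g_0=0$). Let $u=\min\{t\ge 0: g_t\notin S\}$ and $\upsilon=\min\{b\ge 1: bm_n\in\Gamma'\}$. Then these minima exist, and there are unique integers $0\le w\le\upsilon-1$, $0\le z\le u-1$, $\lambda\ge 1$, $\mu\ge 0$, $\nu\ge 2$ with $$g_u=\lambda m_0+wm_n,\qquad \upsilon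 m_n=\mu m_0+g_z,\qquad g_{u-z}+(\upsilon-w)m_n=\nu m_0,$$ where $\nu=\lambda+\mu+1$ if $r_{u-z}<r_u$ and $\nu=\lambda+\mu$ if $r_{u-z}\ge r_u$. Let $q=q_u$, $r=r_u$, $q'=q_{u-z}$, $r'=r_{u-z}$, and set $$\varphi_i=x_{r+i}x_p^{q}-x_0^{\lambda-1}x_ix_n^{w}\quad(0\le i\le p-r),\qquad \psi_j=x_{r'+j}x_p^{q'}x_n^{\upsilon-w}-x_0^{\nu-1}x_j\quad(0\le j\le p-r'),$$ $$\theta=x_n^{\upsilon}-x_0^{\mu}x_{r_z}x_p^{q_z}\quad(\text{with } x_{r_z}x_p^{q_z}=x_px_p^{-1}=1 \text{ if } z=0),$$ $$\xi_{i,j}=\begin{cases}x_ix_j-x_0x_{i+j}& \text{if } i+j\le p,\\ x_ix_j-x_{i+j-p}x_p&\text{if } i+j>p,\end{cases}\quad(1\le i\le j\le p-1).$$ Consider the graded reverse lexicographic order with grading $wt(x_i)=m_i$ and $x_0<x_1<\cdots<x_n$: a monomial of larger weight is larger, and among monomials of equal weight $\prod x_i^{a_i}>\prod x_i^{b_i}$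 if the left-most nonzero entry of $(a_0-b_0,\dots,a_n-b_n)$ is negative. A minimal Groebner basis of an ideal is a Groebner basis all of whose elements have leading coefficient $1$ and none of whose elements has its leading monomial in the ideal generated by the leading monomials of the others. **Theorem.** The set $$G=\{\varphi_i: 0\le i\le p-r\}\cup\{\theta\}\cup\{\xi_{i,j}: 1\le i\le j\le p-1\}\cup\{\psi_j: 0\le j\le p-r'\}$$ is a Groebner basis of $P$ with respect to this order. In general it is not a minimal Groebner basis: if $q_z=0$ and $r_z<r$, then $G$ is not a minimal Groebner basis of $P$, and for every field $K$ there are $n$ and $m_0,\dots,m_n$ as above for which $q_z=0$ and $r_z<r$. -/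

import Mathlib

/-! ### The weighted graded reverse lexicographic order -/

/-- Exponent vectors of monomials in `x_0, …, x_{N-1}`, to be compared by the weighted graded
reverse lexicographic order with weights `wt x_i = w i` and `x_0 < x_1 < ⋯ < x_{N-1}`. -/
def WGrevlex {N : ℕ} (_w : Fin N → ℕ) : Type := Fin N →₀ ℕ

namespace WGrevlex

variable {N : ℕ} (w : Fin N → ℕ)

noncomputable instance : AddCommMonoid (WGrevlex w) :=
  inferInstanceAs (AddCommMonoid (Fin N →₀ ℕ))

/-- The identity map from exponent vectors to the ordered synonym. -/
noncomputable def ofExp : (Fin N →₀ ℕ) ≃+ WGrevlex w := AddEquiv.refl _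

/-- The comparison key: first the weighted degree; then, for equal weighted degrees, the
order dual of the lexicographic order of `(a_0, …, a_{N-1})`, so that the larger monomial is the
one with the smaller exponent at the first place where the exponents differ. -/
noncomputable def key (a : WGrevlex w) : ℕ ×ₗ (Lex (Fin N → ℕ))ᵒᵈ :=
  toLex (Finsupp.weight w ((ofExp w).symm a), OrderDual.toDual (toLex ⇑((ofExp w).symm a)))

theorem key_injective : Function.Injective (key w) := by
  intro a b h
  have h2 := congrArg (fun z => (ofLex z).2) h
  exact DFunLike.coe_injective (F := Fin N →₀ ℕ) (toLex.injective (OrderDual.toDual.injective h2))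

noncomputable instance : LinearOrder (WGrevlex w) := LinearOrder.lift' (key w) (key_injective w)

theorem lt_iff (a b : Fin N →₀ ℕ) :
    ofExp w a < ofExp w b ↔
      Finsupp.weight w a < Finsupp.weight w b ∨
        (Finsupp.weight w a = Finsupp.weight w b ∧ ∃ i, (∀ j < i, b j = a j) ∧ b i < a i) :=
  Prod.Lex.toLex_lt_toLex

theorem le_iff (a b : Fin N →₀ ℕ) :
    ofExp w a ≤ ofExp w b ↔
      Finsupp.weight w a < Finsupp.weight w b ∨
        (Finsupp.weight w a = Finsupp.weight w b ∧ toLex ⇑b ≤ toLex ⇑a) :=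
  Prod.Lex.toLex_le_toLex

instance : IsOrderedAddMonoid (WGrevlex w) where
  add_le_add_left a b h c := by
    obtain ⟨a, rfl⟩ := (ofExp w).surjective a
    obtain ⟨b, rfl⟩ := (ofExp w).surjective b
    obtain ⟨c, rfl⟩ := (ofExp w).surjective c
    rw [← map_add, ← map_add, le_iff, map_add, map_add]
    rw [le_iff] at h
    rcases h with h | ⟨h1, h2⟩
    · left; omega
    · right
      refine ⟨by omega, ?_⟩
      have := add_le_add_left h2 (toLex ⇑c)
      simpa using this

theorem wellFoundedLT (hw : ∀ i, 0 < w i) : WellFoundedLT (WGrevlex w) := by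
  refine ⟨WellFounded.wellFounded_iff_has_min.2 fun s hs => ?_⟩
  let d : WGrevlex w → ℕ := fun a => Finsupp.weight w ((ofExp w).symm a)
  obtain ⟨x, hx, hmin⟩ := (InvImage.wf d Nat.lt_wfRel.wf).has_min s hs
  have hfin : {a : WGrevlex w | a ∈ s ∧ d a = d x}.Finite := by
    refine (Finsupp.finite_of_nat_weight_le w (fun i => (hw i).ne') (d x)).subset ?_
    intro a ha
    exact ha.2.le
  obtain ⟨y, hy⟩ := hfin.exists_minimal ⟨x, hx, rfl⟩
  refine ⟨y, hy.1.1, fun z hz hlt => ?_⟩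
  have h1 : ¬ d z < d x := hmin z hz
  have h2 : d z < d y ∨ (d z = d y ∧ _) := (lt_iff w z y).1 hlt
  have h3 : d y = d x := hy.1.2
  have h4 : d z = d x := by omega
  exact absurd (hy.2 ⟨hz, h4⟩ hlt.le) (not_le.2 hlt)

theorem ofExp_monotone (hw : ∀ i, 0 < w i) : Monotone (ofExp w) := by
  intro a b h
  obtain ⟨c, rfl⟩ := exists_add_of_le h
  rw [le_iff, map_add]
  rcases Nat.eq_zero_or_pos (Finsupp.weight w c) with hc | hc
  · have : c = 0 := by
      have := Finsupp.nonTorsionWeight_of (R := ℕ) (w := w) fun i => (hw i).ne'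
      exact (Finsupp.weight_eq_zero_iff_eq_zero w).1 hc
    subst this
    simp
  · left; omega

end WGrevlex

/-- The graded reverse lexicographic monomial order with grading `wt x_i = w i` (positive weights)
and `x_0 < x_1 < ⋯`: see `WGrevlex.lt_iff` for the explicit form of the comparison. -/
noncomputable def weightedGrevlex {N : ℕ} (w : Fin N → ℕ) (hw : ∀ i, 0 < w i) :
    MonomialOrder (Fin N) where
  syn := WGrevlex w
  toSyn := WGrevlex.ofExp w
  toSyn_monotone := WGrevlex.ofExp_monotone w hw
  wellFoundedLT_syn := WGrevlex.wellFoundedLT w hw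

/-! ### Groebner bases -/

section Groebner

variable {σ K : Type*} [Field K]

/-- `G` is a Groebner basis of the ideal `I`: a finite subset of `I` whose leading terms generate
the ideal of all leading terms of elements of `I`. -/
def IsGroebnerBasis (ord : MonomialOrder σ) (I : Ideal (MvPolynomial σ K))
    (G : Set (MvPolynomial σ K)) : Prop :=
  G.Finite ∧ G ⊆ I ∧
    Ideal.span (ord.leadingTerm '' G) = Ideal.span (ord.leadingTerm '' (I : Set (MvPolynomial σ K)))

/-- A minimal Groebner basis: every element is monic, and no leading monomial lies in the ideal
generated by the leading monomials of the other elements. (Under the first condition leading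
terms and leading monomials agree.) -/
def IsMinimalGroebnerBasis (ord : MonomialOrder σ) (I : Ideal (MvPolynomial σ K))
    (G : Set (MvPolynomial σ K)) : Prop :=
  IsGroebnerBasis ord I G ∧ (∀ f ∈ G, ord.leadingCoeff f = 1) ∧
    ∀ f ∈ G, ord.leadingTerm f ∉ Ideal.span (ord.leadingTerm '' (G \ {f}))

end Groebner

/-! ### Almost arithmetic sequences and their parameters

The sequence is `m_0, …, m_n` with `n = p + 1`; the variables are indexed by `Fin (p + 2)`. -/

namespace AlmostArith

/-- The index `k`, for a natural number `k ≤ n = p + 1`. -/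
def ix (p k : ℕ) : Fin (p + 2) := Fin.ofNat (p + 2) k

/-- The standing assumptions on `m_0, …, m_n`, `n = p + 1 ≥ 2`: positive integers, of which
`m_0 < ⋯ < m_p` form an arithmetic sequence, with greatest common divisor one and
generating minimally the numerical semigroup that they generate. -/
structure IsAlmostArithmetic (p : ℕ) (m : Fin (p + 2) → ℕ) : Prop where
  one_le_p : 1 ≤ p
  pos : ∀ i, 0 < m i
  arith : ∃ d : ℕ, 0 < d ∧ ∀ k ≤ p, m (ix p k) = m (ix p 0) + k * d
  gcd_eq_one : Finset.univ.gcd m = 1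
  minimal : ∀ i, m i ∉ AddSubmonoid.closure (m '' {j | j ≠ i})

variable (p : ℕ) (m : Fin (p + 2) → ℕ)

/-- The semigroup `Γ = ℕ m_0 + ⋯ + ℕ m_n`, as a submonoid of `ℤ`. -/
def Gam : AddSubmonoid ℤ := AddSubmonoid.closure {x | ∃ k ≤ p + 1, x = (m (ix p k) : ℤ)}

/-- The semigroup `Γ' = ℕ m_0 + ⋯ + ℕ m_p`, as a submonoid of `ℤ`. -/
def Gam' : AddSubmonoid ℤ := AddSubmonoid.closure {x | ∃ k ≤ p, x = (m (ix p k) : ℤ)}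

/-- `S`, the set of all `γ ∈ Γ` with `γ - m_0 ∉ Γ`. -/
def S : Set ℤ := {x | x ∈ Gam p m ∧ x - (m (ix p 0) : ℤ) ∉ Gam p m}

/-- The quotient `q_t` in `t = q_t p + r_t` with `r_t ∈ [1, p]`; note `q_0 = -1`. -/
def quo (t : ℕ) : ℤ := ((t : ℤ) - 1) / (p : ℤ)

/-- The remainder `r_t ∈ [1, p]` in `t = q_t p + r_t`; note `r_0 = p`. -/
def rem (t : ℕ) : ℕ := (((t : ℤ) - 1) % (p : ℤ)).toNat + 1

theorem quo_rem (hp : 1 ≤ p) (t : ℕ) :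
    (t : ℤ) = quo p t * p + rem p t ∧ 1 ≤ rem p t ∧ rem p t ≤ p := by
  have h0 : (0 : ℤ) < p := by exact_mod_cast hp
  have h1 := Int.emod_nonneg ((t : ℤ) - 1) h0.ne'
  have h2 := Int.emod_lt_of_pos ((t : ℤ) - 1) h0
  have h3 := Int.mul_ediv_add_emod ((t : ℤ) - 1) p
  unfold quo rem
  refine ⟨?_, by omega, by omega⟩
  push_cast
  rw [Int.toNat_of_nonneg h1]
  linarith [mul_comm (p : ℤ) (((t : ℤ) - 1) / p)]

/-- `g_t = q_t m_p + m_{r_t}`. -/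
def g (t : ℕ) : ℤ := quo p t * (m (ix p p) : ℤ) + (m (ix p (rem p t)) : ℤ)

/-- A tuple `(u, υ, w, z, λ, μ, ν)` of natural numbers. -/
structure Params where
  u : ℕ
  v : ℕ
  w : ℕ
  z : ℕ
  lam : ℕ
  mu : ℕ
  nu : ℕ

/-- The conditions that define the parameters `u, υ, w, z, λ, μ, ν` of the sequence `m`. -/
structure IsParams (π : Params) : Prop where
  u_least : IsLeast {t : ℕ | g p m t ∉ S p m} π.u
  v_least : IsLeast {b : ℕ | 1 ≤ b ∧ (b : ℤ) * (m (ix p (p + 1)) : ℤ) ∈ Gam' p m} π.v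
  w_lt : π.w < π.v
  z_lt : π.z < π.u
  one_le_lam : 1 ≤ π.lam
  two_le_nu : 2 ≤ π.nu
  g_u : g p m π.u = π.lam * (m (ix p 0) : ℤ) + π.w * (m (ix p (p + 1)) : ℤ)
  v_mul : (π.v : ℤ) * (m (ix p (p + 1)) : ℤ) = π.mu * (m (ix p 0) : ℤ) + g p m π.z
  g_u_sub_z : g p m (π.u - π.z) + ((π.v : ℤ) - π.w) * (m (ix p (p + 1)) : ℤ)
    = π.nu * (m (ix p 0) : ℤ)
  nu_eq : π.nu = if rem p (π.u - π.z) < rem p π.u then π.lam + π.mu + 1 else π.lam + π.mu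

/-! ### The ideal and the Patil–Singh generators -/

open MvPolynomial

variable (K : Type*) [Field K]

/-- The defining ideal `P` of the curve `x_i = t ^ m_i`: the kernel of the `K`-algebra
homomorphism `K[x_0, …, x_n] → K[t]`, `x_i ↦ t ^ m_i`. -/
noncomputable def curveIdeal : Ideal (MvPolynomial (Fin (p + 2)) K) :=
  RingHom.ker (aeval (fun i => (Polynomial.X : Polynomial K) ^ m i) :
    MvPolynomial (Fin (p + 2)) K →ₐ[K] Polynomial K)

/-- The variable `x_k`, for `k ≤ n = p + 1`. -/
noncomputable def x (k : ℕ) : MvPolynomial (Fin (p + 2)) K := X (ix p k)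

/-- The monomial `x_{r_t} x_p ^ {q_t}`. For `t = 0`, where `r_0 = p` and `q_0 = -1`, the two
factors cancel and the monomial is `1`; for `t ≥ 1` one has `q_t ≥ 0`. -/
noncomputable def gMon (t : ℕ) : MvPolynomial (Fin (p + 2)) K :=
  if t = 0 then 1 else x p K (rem p t) * x p K p ^ (quo p t).toNat

/-- `ξ_{i,j} = x_i x_j - x_0 x_{i+j}` if `i + j ≤ p`, and `x_i x_j - x_{i+j-p} x_p` otherwise. -/
noncomputable def xi (i j : ℕ) : MvPolynomial (Fin (p + 2)) K :=
  if i + j ≤ p then x p K i * x p K j - x p K 0 * x p K (i + j)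
  else x p K i * x p K j - x p K (i + j - p) * x p K p

/-- `φ_i = x_{r+i} x_p ^ q - x_0 ^ (λ-1) x_i x_n ^ w`, where `u = q p + r`. -/
noncomputable def phi (π : Params) (i : ℕ) : MvPolynomial (Fin (p + 2)) K :=
  x p K (rem p π.u + i) * x p K p ^ (quo p π.u).toNat
    - x p K 0 ^ (π.lam - 1) * x p K i * x p K (p + 1) ^ π.w

/-- `ψ_j = x_{r'+j} x_p ^ q' x_n ^ (υ-w) - x_0 ^ (ν-1) x_j`, where `u - z = q' p + r'`. -/
noncomputable def psi (π : Params) (j : ℕ) : MvPolynomial (Fin (p + 2)) K :=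
  x p K (rem p (π.u - π.z) + j) * x p K p ^ (quo p (π.u - π.z)).toNat
      * x p K (p + 1) ^ (π.v - π.w)
    - x p K 0 ^ (π.nu - 1) * x p K j

/-- `θ = x_n ^ υ - x_0 ^ μ x_{r_z} x_p ^ {q_z}`. -/
noncomputable def theta (π : Params) : MvPolynomial (Fin (p + 2)) K :=
  x p K (p + 1) ^ π.v - x p K 0 ^ π.mu * gMon p K π.z

/-- The full set of Patil–Singh generators. -/
def patilSingh (π : Params) : Set (MvPolynomial (Fin (p + 2)) K) :=
  {f | ∃ i, i ≤ p - rem p π.u ∧ f = phi p K π i} ∪ {theta p K π} ∪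
    {f | ∃ i j, 1 ≤ i ∧ i ≤ j ∧ j ≤ p - 1 ∧ f = xi p K i j} ∪
    {f | ∃ j, j ≤ p - rem p (π.u - π.z) ∧ f = psi p K π j}

end AlmostArith

/-!
The generators are binomials that are homogeneous for the weights `m_i`. In the image of an
element of the curve ideal in `K[t]`, the terms of each weight have to cancel, so the leading
monomial of a nonzero element is never the least monomial of its weight
(`exists_lt_degree_of_aeval_eq_zero`). On the other hand, the least monomial of a given weight is
standard, that is, divisible by no leading monomial of a generator, since otherwise the generator
would rewrite it to a smaller monomial of the same weight. So the generators form a Groebner basis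
as soon as different standard monomials have different weights
(`isGroebnerBasis_of_weight_injOn`).

The leading terms of the `ξ_{i,j}` force a standard monomial to be of the form
`x_0 ^ a x_{r_t} x_p ^ {q_t} x_n ^ b`, of weight `a m_0 + g_t + b m_n`, and those of `φ_i`, `θ` and
`ψ_j` give `t < u`, `b < υ`, and `t < u - z` or `b < υ - w`. That the weight then determines
`(a, t, b)` is `IsParams.eq_of_weight_eq`. It rests on three facts: `g_s + g_t` is `g_{s+t}` or
`g_{s+t} + m_0` (`IsAlmostArithmetic.g_add`, from `g_t = (q_t + 1) m_0 + t d`), an element of `S`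
has no representation involving `m_0`, and no `b m_n` with `1 ≤ b < υ` lies in `Γ'`. The same facts
give existence and uniqueness of the parameters: `w` and `z` are found by descent.

If `q_z = 0` and `r_z < r`, the leading monomial of `ψ_z` is a multiple of that of `φ_0`, and the
sequence `7, 8, 9, 11` is an instance of this, over every field.
-/

namespace AlmostArith

/-! ### The numbers `g_t` and the semigroups they describe -/

theorem quo_eq_and_rem_eq {p : ℕ} (hp : 1 ≤ p) {t r : ℕ} {q : ℤ} (h : (t : ℤ) = q * p + r)
    (h1 : 1 ≤ r) (h2 : r ≤ p) : quo p t = q ∧ rem p t = r := by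
  have hp0 : (p : ℤ) ≠ 0 := by omega
  have e : (t : ℤ) - 1 = (r - 1 : ℤ) + q * p := by rw [h]; ring
  have hq : quo p t = q := by
    unfold quo
    rw [e, Int.add_mul_ediv_right _ _ hp0, Int.ediv_eq_zero_of_lt (by omega) (by omega), zero_add]
  refine ⟨hq, ?_⟩
  have := (quo_rem p hp t).1
  rw [hq] at this
  omega

theorem quo_zero {p : ℕ} (hp : 1 ≤ p) : quo p 0 = -1 :=
  (quo_eq_and_rem_eq hp (r := p) (by push_cast; ring) hp le_rfl).1

theorem quo_nonneg {p t : ℕ} (ht : 1 ≤ t) : 0 ≤ quo p t :=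
  Int.ediv_nonneg (by omega) (by omega)

theorem quo_mono {p : ℕ} (hp : 1 ≤ p) : Monotone (quo p) := fun s t h =>
  Int.ediv_le_ediv (by omega) (by omega)

/-- The quotients are additive up to a carry, which occurs unless the remainder increases. -/
theorem quo_add {p : ℕ} (hp : 1 ≤ p) (s t : ℕ) :
    quo p s + quo p t + 1 = quo p (s + t) + if rem p s < rem p (s + t) then 1 else 0 := by
  obtain ⟨hs, hs1, hs2⟩ := quo_rem p hp s
  obtain ⟨ht, ht1, ht2⟩ := quo_rem p hp t
  by_cases h : rem p s + rem p t ≤ p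
  · obtain ⟨e1, e2⟩ := quo_eq_and_rem_eq hp (t := s + t) (r := rem p s + rem p t)
      (q := quo p s + quo p t) (by push_cast; linarith) (by omega) h
    rw [e1, e2, if_pos (by omega)]
  · obtain ⟨e1, e2⟩ := quo_eq_and_rem_eq hp (t := s + t) (r := rem p s + rem p t - p)
      (q := quo p s + quo p t + 1) (by push_cast [show p ≤ rem p s + rem p t by omega]; linarith)
      (by omega) (by omega)
    rw [e1, e2, if_neg (by omega)]; ring

namespace IsAlmostArithmetic

variable {p : ℕ} {m : Fin (p + 2) → ℕ}

theorem zero_lt (hm : IsAlmostArithmetic p m) (k : ℕ) : (0 : ℤ) < m (ix p k) := by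
  exact_mod_cast hm.pos _

theorem g_eq (hm : IsAlmostArithmetic p m) : ∃ d : ℕ, 0 < d ∧
    (∀ k ≤ p, (m (ix p k) : ℤ) = m (ix p 0) + k * d) ∧
    ∀ t : ℕ, g p m t = (quo p t + 1) * m (ix p 0) + t * d := by
  obtain ⟨d, hd, h⟩ := hm.arith
  have h' : ∀ k ≤ p, (m (ix p k) : ℤ) = m (ix p 0) + k * d := fun k hk => by
    rw [h k hk]; push_cast; ring
  refine ⟨d, hd, h', fun t => ?_⟩
  obtain ⟨e, -, h2⟩ := quo_rem p hm.one_le_p t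
  rw [g, h' _ le_rfl, h' _ h2]
  linear_combination (-(d : ℤ)) * e

theorem g_zero (hm : IsAlmostArithmetic p m) : g p m 0 = 0 := by
  obtain ⟨d, -, -, h⟩ := hm.g_eq
  rw [h, quo_zero hm.one_le_p]; simp

theorem g_of_le (hm : IsAlmostArithmetic p m) {k : ℕ} (h1 : 1 ≤ k) (h2 : k ≤ p) :
    g p m k = m (ix p k) := by
  obtain ⟨e1, e2⟩ := quo_eq_and_rem_eq hm.one_le_p (t := k) (r := k) (q := 0) (by simp) h1 h2
  rw [g, e1, e2]; simp

theorem g_strictMono (hm : IsAlmostArithmetic p m) : StrictMono (g p m) := by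
  obtain ⟨d, hd, -, h⟩ := hm.g_eq
  intro s t hst
  rw [h, h]
  have := quo_mono hm.one_le_p hst.le
  have := hm.zero_lt 0
  have : (s : ℤ) < t := by exact_mod_cast hst
  have : (0 : ℤ) < d := by exact_mod_cast hd
  nlinarith

theorem g_nonneg (hm : IsAlmostArithmetic p m) (t : ℕ) : 0 ≤ g p m t := by
  rw [← hm.g_zero]; exact hm.g_strictMono.monotone (Nat.zero_le t)

/-- For `t ≥ 1`, `g_t` exceeds `m_0`. -/
theorem lt_g (hm : IsAlmostArithmetic p m) {t : ℕ} (ht : 1 ≤ t) : (m (ix p 0) : ℤ) < g p m t := by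
  obtain ⟨d, hd, -, h⟩ := hm.g_eq
  rw [h]
  have := quo_nonneg (p := p) ht
  have := hm.zero_lt 0
  have : (0 : ℤ) < d := by exact_mod_cast hd
  have : (1 : ℤ) ≤ t := by exact_mod_cast ht
  nlinarith

theorem g_add (hm : IsAlmostArithmetic p m) (s t : ℕ) :
    g p m s + g p m t
      = g p m (s + t) + (if rem p s < rem p (s + t) then 1 else 0) * m (ix p 0) := by
  obtain ⟨d, -, -, h⟩ := hm.g_eq
  rw [h, h, h]
  push_cast
  linear_combination (m (ix p 0) : ℤ) * quo_add hm.one_le_p s t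

/-- The carry of `g_add`, when only its range matters. -/
theorem exists_g_add (hm : IsAlmostArithmetic p m) (s t : ℕ) :
    ∃ ε : ℕ, ε ≤ 1 ∧ g p m s + g p m t = g p m (s + t) + ε * m (ix p 0) := by
  have := hm.g_add s t
  split_ifs at this
  · exact ⟨1, le_rfl, by simpa using this⟩
  · exact ⟨0, zero_le_one, by simpa using this⟩

theorem exists_g_sub (hm : IsAlmostArithmetic p m) {s t : ℕ} (h : s ≤ t) :
    ∃ ε : ℕ, ε ≤ 1 ∧ g p m s + g p m (t - s) = g p m t + ε * m (ix p 0) := by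
  have := hm.exists_g_add s (t - s)
  rwa [Nat.add_sub_cancel' h] at this

theorem coe_mem_Gam' {k : ℕ} (hk : k ≤ p) : (m (ix p k) : ℤ) ∈ Gam' p m :=
  AddSubmonoid.subset_closure ⟨k, hk, rfl⟩

theorem g_mem_Gam' (hm : IsAlmostArithmetic p m) (t : ℕ) : g p m t ∈ Gam' p m := by
  rcases Nat.eq_zero_or_pos t with rfl | ht
  · rw [hm.g_zero]; exact zero_mem _
  · obtain ⟨-, -, h2⟩ := quo_rem p hm.one_le_p t
    rw [g, ← Int.toNat_of_nonneg (quo_nonneg (p := p) ht), ← nsmul_eq_mul]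
    exact add_mem (nsmul_mem (coe_mem_Gam' le_rfl) _) (coe_mem_Gam' h2)

theorem mem_Gam'_iff (hm : IsAlmostArithmetic p m) (y : ℤ) :
    y ∈ Gam' p m ↔ ∃ a t : ℕ, y = a * m (ix p 0) + g p m t := by
  constructor
  · intro h
    induction h using AddSubmonoid.closure_induction with
    | mem y hy =>
      obtain ⟨k, hk, rfl⟩ := hy
      rcases Nat.eq_zero_or_pos k with rfl | h1
      · exact ⟨1, 0, by simp [hm.g_zero]⟩
      · exact ⟨0, k, by simp [hm.g_of_le h1 hk]⟩
    | zero => exact ⟨0, 0, by simp [hm.g_zero]⟩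
    | add y y' _ _ h h' =>
      obtain ⟨a, t, rfl⟩ := h
      obtain ⟨a', t', rfl⟩ := h'
      obtain ⟨ε, -, e⟩ := hm.exists_g_add t t'
      exact ⟨a + a' + ε, t + t', by push_cast; linear_combination e⟩
  · rintro ⟨a, t, rfl⟩
    rw [← nsmul_eq_mul]
    exact add_mem (nsmul_mem (coe_mem_Gam' (Nat.zero_le _)) _) (hm.g_mem_Gam' t)

theorem mem_Gam_iff (hm : IsAlmostArithmetic p m) (y : ℤ) :
    y ∈ Gam p m ↔ ∃ a t b : ℕ, y = a * m (ix p 0) + g p m t + b * m (ix p (p + 1)) := by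
  constructor
  · intro h
    induction h using AddSubmonoid.closure_induction with
    | mem y hy =>
      obtain ⟨k, hk, rfl⟩ := hy
      rcases Nat.lt_or_ge p k with h1 | h1
      · obtain rfl : k = p + 1 := by omega
        exact ⟨0, 0, 1, by simp [hm.g_zero]⟩
      · obtain ⟨a, t, h⟩ := (hm.mem_Gam'_iff _).1 (coe_mem_Gam' (m := m) h1)
        exact ⟨a, t, 0, by simpa using h⟩
    | zero => exact ⟨0, 0, 0, by simp [hm.g_zero]⟩
    | add y y' _ _ h h' =>
      obtain ⟨a, t, b, rfl⟩ := h
      obtain ⟨a', t', b', rfl⟩ := h'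
      obtain ⟨ε, -, e⟩ := hm.exists_g_add t t'
      exact ⟨a + a' + ε, t + t', b + b', by push_cast; linear_combination e⟩
  · rintro ⟨a, t, b, rfl⟩
    have h : Gam' p m ≤ Gam p m := AddSubmonoid.closure_mono fun y ⟨k, hk, e⟩ => ⟨k, by omega, e⟩
    have hn : (m (ix p (p + 1)) : ℤ) ∈ Gam p m :=
      AddSubmonoid.subset_closure ⟨p + 1, le_rfl, rfl⟩
    rw [← nsmul_eq_mul b]
    exact add_mem (h ((hm.mem_Gam'_iff _).2 ⟨a, t, rfl⟩)) (nsmul_mem hn _)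

/-- An element of `S` has no representation that involves `m_0`. -/
theorem not_mem_S (hm : IsAlmostArithmetic p m) {a t b : ℕ} (ha : 1 ≤ a) :
    (a * m (ix p 0) + g p m t + b * m (ix p (p + 1)) : ℤ) ∉ S p m := by
  refine fun h => h.2 ((hm.mem_Gam_iff _).2 ⟨a - 1, t, b, ?_⟩)
  push_cast [ha]; ring

theorem exists_of_g_not_mem_S (hm : IsAlmostArithmetic p m) {s : ℕ} (h : g p m s ∉ S p m) :
    ∃ a t b : ℕ, 1 ≤ a ∧ g p m s = a * m (ix p 0) + g p m t + b * m (ix p (p + 1)) := by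
  have h1 : g p m s ∈ Gam p m := (hm.mem_Gam_iff _).2 ⟨0, s, 0, by simp⟩
  have h2 : g p m s - m (ix p 0) ∈ Gam p m := by
    by_contra h2; exact h ⟨h1, h2⟩
  obtain ⟨a, t, b, e⟩ := (hm.mem_Gam_iff _).1 h2
  exact ⟨a + 1, t, b, by omega, by push_cast; linear_combination e⟩

theorem g_zero_mem_S (hm : IsAlmostArithmetic p m) : g p m 0 ∈ S p m := by
  by_contra h
  obtain ⟨a, t, b, ha, e⟩ := hm.exists_of_g_not_mem_S h
  have h0 := hm.zero_lt 0
  have h1 := hm.zero_lt (p + 1)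
  have h2 := hm.g_nonneg t
  have : (1 : ℤ) ≤ a := by exact_mod_cast ha
  rw [hm.g_zero] at e
  nlinarith

theorem exists_g_not_mem_S (hm : IsAlmostArithmetic p m) : ∃ t, g p m t ∉ S p m := by
  obtain ⟨d, -, -, h⟩ := hm.g_eq
  refine ⟨m (ix p 0), ?_⟩
  have hq := quo_nonneg (p := p) (hm.pos (ix p 0))
  have := hm.not_mem_S (a := (quo p (m (ix p 0)) + 1).toNat + d) (t := 0) (b := 0) (by omega)
  rw [hm.g_zero, Nat.cast_add, Int.toNat_of_nonneg (by omega)] at this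
  rw [h]
  convert this using 2
  push_cast
  ring

/-! ### Existence and uniqueness of the parameters -/

theorem exists_isLeast_u (hm : IsAlmostArithmetic p m) :
    ∃ u, IsLeast {t : ℕ | g p m t ∉ S p m} u := by
  classical
  exact ⟨_, Nat.isLeast_find hm.exists_g_not_mem_S⟩

theorem exists_isLeast_v (hm : IsAlmostArithmetic p m) :
    ∃ v, IsLeast {b : ℕ | 1 ≤ b ∧ (b : ℤ) * (m (ix p (p + 1)) : ℤ) ∈ Gam' p m} v := by
  classical
  have : ∃ b : ℕ, 1 ≤ b ∧ (b : ℤ) * (m (ix p (p + 1)) : ℤ) ∈ Gam' p m :=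
    ⟨m (ix p 0), hm.pos _, (hm.mem_Gam'_iff _).2
      ⟨m (ix p (p + 1)), 0, by rw [hm.g_zero]; ring⟩⟩
  exact ⟨_, Nat.isLeast_find this⟩

section

variable {u v : ℕ}

theorem one_le_u (hm : IsAlmostArithmetic p m) (hu : IsLeast {t : ℕ | g p m t ∉ S p m} u) :
    1 ≤ u := by
  rcases Nat.eq_zero_or_pos u with rfl | h
  · exact absurd hm.g_zero_mem_S hu.1
  · exact h

/-- Below `u`, an equation `g_t = a m_0 + g_s + b m_n` in integers forces `a ≤ 0`. -/
theorem le_zero_of_g_eq (hm : IsAlmostArithmetic p m)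
    (hu : IsLeast {t : ℕ | g p m t ∉ S p m} u) {t s b : ℕ} {a : ℤ} (ht : t < u)
    (e : g p m t = a * m (ix p 0) + g p m s + b * m (ix p (p + 1))) : a ≤ 0 := by
  by_contra! ha
  lift a to ℕ using ha.le
  have h : g p m t ∉ S p m := by rw [e]; exact hm.not_mem_S (by omega)
  exact absurd (hu.2 h) (by omega)

theorem eq_of_g_eq (hm : IsAlmostArithmetic p m)
    (hu : IsLeast {t : ℕ | g p m t ∉ S p m} u) {s t : ℕ} {a : ℤ} (hs : s < u) (ht : t < u)
    (e : g p m t = a * m (ix p 0) + g p m s) : s = t := by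
  have h1 := hm.le_zero_of_g_eq hu (s := s) (b := 0) (a := a) ht (by rw [e]; simp)
  have h2 := hm.le_zero_of_g_eq hu (s := t) (b := 0) (a := -a) hs (by rw [e]; simp)
  obtain rfl : a = 0 := by omega
  exact hm.g_strictMono.injective (by simpa using e.symm)

/-- An equation `b m_n = a m_0 + g_t` in integers with `1 ≤ b < υ` forces `a < 0`. -/
theorem neg_of_mul_eq (hm : IsAlmostArithmetic p m)
    (hv : IsLeast {b : ℕ | 1 ≤ b ∧ (b : ℤ) * (m (ix p (p + 1)) : ℤ) ∈ Gam' p m} v)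
    {b t : ℕ} {a : ℤ} (h1 : 1 ≤ b) (h2 : b < v)
    (e : (b : ℤ) * m (ix p (p + 1)) = a * m (ix p 0) + g p m t) : a < 0 := by
  by_contra! ha
  lift a to ℕ using ha
  exact absurd (hv.2 ⟨h1, (hm.mem_Gam'_iff _).2 ⟨a, t, e⟩⟩) (by omega)

/-- A representation of `g_u` that involves `m_0` cannot involve any `g_t` with `t ≥ 1`. -/
theorem eq_zero_of_g_u_eq (hm : IsAlmostArithmetic p m)
    (hu : IsLeast {t : ℕ | g p m t ∉ S p m} u) {a t b : ℕ} (ha : 1 ≤ a)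
    (e : g p m u = a * m (ix p 0) + g p m t + b * m (ix p (p + 1))) : t = 0 := by
  have h0 := hm.zero_lt 0
  have h1 := hm.zero_lt (p + 1)
  have ha' : (1 : ℤ) ≤ a := by exact_mod_cast ha
  by_contra ht
  rcases le_or_gt t u with h | h
  · obtain ⟨ε, -, e'⟩ := hm.exists_g_sub h
    have := hm.le_zero_of_g_eq hu (t := u - t) (s := 0) (b := b) (a := a + ε) (by omega)
      (by rw [hm.g_zero]; linear_combination e + e')
    omega
  · have := hm.g_strictMono h
    have : (0 : ℤ) ≤ b * m (ix p (p + 1)) := by positivity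
    nlinarith

theorem exists_z (hm : IsAlmostArithmetic p m)
    (hu : IsLeast {t : ℕ | g p m t ∉ S p m} u)
    (hv : IsLeast {b : ℕ | 1 ≤ b ∧ (b : ℤ) * (m (ix p (p + 1)) : ℤ) ∈ Gam' p m} v)
    {w lam : ℕ} (hw : w < v) (hlam : 1 ≤ lam)
    (e : g p m u = lam * (m (ix p 0) : ℤ) + w * (m (ix p (p + 1)) : ℤ)) :
    ∃ z mu : ℕ, z < u ∧ (v : ℤ) * (m (ix p (p + 1)) : ℤ) = mu * (m (ix p 0) : ℤ) + g p m z := by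
  classical
  -- take `z` least among all representations of `v m_n`
  have hex : ∃ z mu : ℕ, (v : ℤ) * (m (ix p (p + 1)) : ℤ) = mu * (m (ix p 0) : ℤ) + g p m z := by
    obtain ⟨a, t, h⟩ := (hm.mem_Gam'_iff _).1 hv.1.2
    exact ⟨t, a, h⟩
  obtain ⟨mu, hz⟩ := Nat.find_spec hex
  have hmin := fun k => Nat.find_min hex (m := k)
  set z := Nat.find hex
  refine ⟨z, mu, ?_, hz⟩
  by_contra! hzu
  obtain ⟨ε, hε, e'⟩ := hm.exists_g_sub hzu
  have hu1 := hm.one_le_u hu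
  have e2 : ((v : ℤ) - w) * m (ix p (p + 1)) = ((mu + lam - ε : ℕ) : ℤ) * m (ix p 0)
      + g p m (z - u) := by
    push_cast [show ε ≤ mu + lam by omega]
    linear_combination hz - e' + e
  have hw0 : w = 0 := by
    have := hv.2 ⟨(by omega : 1 ≤ v - w),
      (hm.mem_Gam'_iff _).2 ⟨_, _, by push_cast [hw.le]; exact e2⟩⟩
    omega
  subst hw0
  exact hmin (z - u) (by omega) ⟨_, by simpa using e2⟩

theorem exists_w (hm : IsAlmostArithmetic p m)
    (hu : IsLeast {t : ℕ | g p m t ∉ S p m} u)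
    (hv : IsLeast {b : ℕ | 1 ≤ b ∧ (b : ℤ) * (m (ix p (p + 1)) : ℤ) ∈ Gam' p m} v) :
    ∃ w lam : ℕ, w < v ∧ 1 ≤ lam ∧
      g p m u = lam * (m (ix p 0) : ℤ) + w * (m (ix p (p + 1)) : ℤ) := by
  classical
  -- take `w` least among all representations of `g_u`
  have hex : ∃ w lam : ℕ, 1 ≤ lam ∧
      g p m u = lam * (m (ix p 0) : ℤ) + w * (m (ix p (p + 1)) : ℤ) := by
    obtain ⟨a, t, b, ha, e⟩ := hm.exists_of_g_not_mem_S hu.1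
    obtain rfl := hm.eq_zero_of_g_u_eq hu ha e
    exact ⟨b, a, ha, by simpa [hm.g_zero] using e⟩
  obtain ⟨lam, hlam, hw⟩ := Nat.find_spec hex
  have hmin := fun k => Nat.find_min hex (m := k)
  set w := Nat.find hex
  refine ⟨w, lam, ?_, hlam, hw⟩
  by_contra! hvw
  obtain ⟨mu, z, e⟩ := (hm.mem_Gam'_iff _).1 hv.1.2
  have e2 : g p m u = ((lam + mu : ℕ) : ℤ) * m (ix p 0) + g p m z
      + ((w - v : ℕ) : ℤ) * m (ix p (p + 1)) := by
    push_cast [hvw]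
    linear_combination hw + e
  obtain rfl := hm.eq_zero_of_g_u_eq hu (by omega) e2
  exact hmin (w - v) (by have := hv.1.1; omega)
    ⟨lam + mu, by omega, by simpa [hm.g_zero] using e2⟩

end

theorem exists_isParams (hm : IsAlmostArithmetic p m) : ∃ π : Params, IsParams p m π := by
  obtain ⟨u, hu⟩ := hm.exists_isLeast_u
  obtain ⟨v, hv⟩ := hm.exists_isLeast_v
  obtain ⟨w, lam, hw, hlam, e1⟩ := hm.exists_w hu hv
  obtain ⟨z, mu, hz, e2⟩ := hm.exists_z hu hv hw hlam e1
  have e3 := hm.g_add (u - z) z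
  rw [Nat.sub_add_cancel hz.le] at e3
  have e4 : g p m (u - z) + ((v : ℤ) - w) * (m (ix p (p + 1)) : ℤ)
      = ((lam + mu + if rem p (u - z) < rem p u then 1 else 0 : ℕ) : ℤ) * m (ix p 0) := by
    push_cast
    linear_combination e3 + e1 + e2
  refine ⟨⟨u, v, w, z, lam, mu, lam + mu + if rem p (u - z) < rem p u then 1 else 0⟩,
    hu, hv, hw, hz, hlam, ?_, e1, e2, e4, ?_⟩
  · -- the left side of the last equation is larger than `m_0`
    dsimp only
    by_contra! hlt
    have h0 := hm.zero_lt 0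
    have h1 := hm.zero_lt (p + 1)
    have h2 := hm.lt_g (t := u - z) (by omega)
    have h3 : (0 : ℤ) < (v : ℤ) - w := by omega
    have h4 : ((lam + mu + if rem p (u - z) < rem p u then 1 else 0 : ℕ) : ℤ) ≤ 1 := by omega
    nlinarith [mul_pos h3 h1]
  · dsimp only
    split_ifs <;> rfl

end IsAlmostArithmetic

namespace IsParams

variable {p : ℕ} {m : Fin (p + 2) → ℕ}

theorem unique (hm : IsAlmostArithmetic p m) {π π' : Params} (h : IsParams p m π)
    (h' : IsParams p m π') : π = π' := by
  have h0 := hm.zero_lt 0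
  have h1 := hm.zero_lt (p + 1)
  obtain ⟨u, v, w, z, lam, mu, nu⟩ := π
  obtain ⟨u', v', w', z', lam', mu', nu'⟩ := π'
  obtain ⟨hu, hv, hw, hz, hlam, -, e1, e2, -, e3⟩ := h
  obtain ⟨hu', hv', hw', hz', hlam', -, e1', e2', -, e3'⟩ := h'
  dsimp only at *
  obtain rfl := hu.unique hu'
  obtain rfl := hv.unique hv'
  have key : ∀ {w w' lam lam' : ℕ}, w' < v →
      (lam * m (ix p 0) + w * m (ix p (p + 1)) : ℤ) = lam' * m (ix p 0) + w' * m (ix p (p + 1)) →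
      ¬ w < w' := by
    intro w w' lam lam' hw' e hlt
    have h3 := hm.neg_of_mul_eq hv (b := w' - w) (t := 0)
      (a := (lam : ℤ) - lam') (by omega) (by omega)
      (by push_cast [hlt.le]; rw [hm.g_zero]; linear_combination -e)
    have h4 : (0 : ℤ) < w' - w := by omega
    nlinarith [mul_pos h4 h1]
  have ew : w = w' := by
    have := key hw' (e1.symm.trans e1')
    have := key hw (e1'.symm.trans e1)
    omega
  subst ew
  have elam : lam = lam' := by
    have : (lam : ℤ) * m (ix p 0) = lam' * m (ix p 0) := by linear_combination e1' - e1
    exact_mod_cast mul_right_cancel₀ h0.ne' this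
  subst elam
  obtain rfl : z = z' := hm.eq_of_g_eq hu (a := (mu : ℤ) - mu') hz hz'
    (by linear_combination e2 - e2')
  have emu : mu = mu' := by
    have : (mu : ℤ) * m (ix p 0) = mu' * m (ix p 0) := by linear_combination e2' - e2
    exact_mod_cast mul_right_cancel₀ h0.ne' this
  subst emu
  rw [e3, e3']

/-! ### Standard monomials are determined by their weight -/

variable {π : Params}

theorem not_lt_of_weight_eq (hm : IsAlmostArithmetic p m) (h : IsParams p m π)
    {a t b a' t' b' : ℕ} (ht : t < π.u) (ht' : t' < π.u) (hb' : b' < π.v)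
    (hs' : t' < π.u - π.z ∨ b' < π.v - π.w)
    (e : (a * m (ix p 0) + g p m t + b * m (ix p (p + 1)) : ℤ)
      = a' * m (ix p 0) + g p m t' + b' * m (ix p (p + 1))) : ¬ b < b' := by
  intro hb
  have hw := h.w_lt
  rcases le_or_gt t' t with hle | hlt
  · -- here `(b' - b) m_n` differs from `g_{t - t'}` by a multiple of `m_0`
    obtain ⟨ε, hε, e1⟩ := hm.exists_g_sub hle
    have h1 := hm.neg_of_mul_eq h.v_least (b := b' - b) (t := t - t')
      (a := (a : ℤ) - ε - a') (by omega) (by omega)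
      (by push_cast [hb.le]; linear_combination -e - e1)
    have h2 := hm.le_zero_of_g_eq h.u_least (t := t - t') (s := 0) (b := b' - b)
      (a := (a' : ℤ) + ε - a) (by omega)
      (by push_cast [hb.le]; rw [hm.g_zero]; linear_combination e + e1)
    omega
  · -- adding `g_{u - t'}` and replacing `g_u` compares `g_{u - (t' - t)}` with `(b' - b + w) m_n`
    obtain ⟨ε, hε, e1⟩ := hm.exists_g_sub ht'.le
    obtain ⟨ε', hε', e2⟩ := hm.exists_g_add t (π.u - t')
    have e3 := h.g_u
    have e4 : g p m (t + (π.u - t')) = ((a' : ℤ) + ε + π.lam - a - ε') * m (ix p 0)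
        + ((b' - b + π.w : ℕ) : ℤ) * m (ix p (p + 1)) := by
      push_cast [hb.le]; linear_combination e + e1 - e2 + e3
    have h1 := hm.le_zero_of_g_eq h.u_least (t := t + (π.u - t')) (s := 0)
      (by omega) (by rw [hm.g_zero, add_zero]; exact e4)
    have h2 : π.v ≤ b' - b + π.w := by
      by_contra! hc
      have := hm.neg_of_mul_eq h.v_least (b := b' - b + π.w)
        (t := t + (π.u - t')) (a := -((a' : ℤ) + ε + π.lam - a - ε')) (by omega) hc
        (by linear_combination -e4)
      omega
    -- so `b' ≥ v - w`, hence `t' < u - z`; now cancel `v m_n = mu m_0 + g_z`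
    have hz : t' < π.u - π.z := by omega
    obtain ⟨ε'', hε'', e5⟩ := hm.exists_g_sub (show π.z ≤ t + (π.u - t') by omega)
    have e6 := h.v_mul
    have e7 : g p m (t + (π.u - t') - π.z)
        = ((a' : ℤ) + ε + π.lam - a - ε' + π.mu + ε'') * m (ix p 0)
        + ((b' - b + π.w - π.v : ℕ) : ℤ) * m (ix p (p + 1)) := by
      push_cast [h2, hb.le]
      push_cast [hb.le] at e4
      linear_combination e5 + e4 + e6
    have h3 := hm.le_zero_of_g_eq h.u_least (t := t + (π.u - t') - π.z) (s := 0)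
      (by omega) (by rw [hm.g_zero, add_zero]; exact e7)
    rcases Nat.eq_zero_or_pos (b' - b + π.w - π.v) with h4 | h4
    · rw [h4] at e7
      have := hm.lt_g (t := t + (π.u - t') - π.z) (by omega)
      have := hm.zero_lt 0
      push_cast at e7
      nlinarith
    · have := hm.neg_of_mul_eq h.v_least (b := b' - b + π.w - π.v)
        (t := t + (π.u - t') - π.z) (a := -((a' : ℤ) + ε + π.lam - a - ε' + π.mu + ε''))
        h4 (by omega) (by linear_combination -e7)
      omega

/-- The exponents `(a, t, b)` of a standard monomial `x_0 ^ a x_{r_t} x_p ^ {q_t} x_n ^ b` are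
determined by its weight. -/
theorem eq_of_weight_eq (hm : IsAlmostArithmetic p m) (h : IsParams p m π)
    {a t b a' t' b' : ℕ} (ht : t < π.u) (ht' : t' < π.u) (hb : b < π.v) (hb' : b' < π.v)
    (hs : t < π.u - π.z ∨ b < π.v - π.w) (hs' : t' < π.u - π.z ∨ b' < π.v - π.w)
    (e : (a * m (ix p 0) + g p m t + b * m (ix p (p + 1)) : ℤ)
      = a' * m (ix p 0) + g p m t' + b' * m (ix p (p + 1))) : a = a' ∧ t = t' ∧ b = b' := by
  have h1 := not_lt_of_weight_eq hm h ht ht' hb' hs' e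
  have h2 := not_lt_of_weight_eq hm h ht' ht hb hs e.symm
  obtain rfl : b = b' := by omega
  obtain rfl : t = t' := hm.eq_of_g_eq h.u_least (a := (a : ℤ) - a') ht ht'
    (by linear_combination -e)
  have : (a : ℤ) * m (ix p 0) = a' * m (ix p 0) := by linear_combination e
  exact ⟨by exact_mod_cast mul_right_cancel₀ (hm.zero_lt 0).ne' this, rfl, rfl⟩

end IsParams

end AlmostArith

/-! ### Binomials and the criterion for Groebner bases -/

section Criterion

open MvPolynomial

variable {N : ℕ} {w : Fin N → ℕ} {hw : ∀ i, 0 < w i} {K : Type*} [Field K]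

/-- For equal weights, a monomial is smaller than another one if it involves a variable such that
the other one involves neither this variable nor any smaller one. -/
theorem WGrevlex.lt_of_weight_eq {a b : Fin N →₀ ℕ}
    (h : Finsupp.weight w a = Finsupp.weight w b) (k : Fin N) (hk : a k ≠ 0)
    (hb : ∀ j ≤ k, b j = 0) : ofExp w a < ofExp w b := by
  classical
  -- compare at the first variable that occurs in `a`
  have hex : ∃ i : Fin N, a i ≠ 0 ∧ ∀ j < i, a j = 0 := by
    obtain ⟨i, hi, hmin⟩ := exists_minimal_of_wellFoundedLT (fun i : Fin N => a i ≠ 0) ⟨k, hk⟩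
    exact ⟨i, hi, fun j hj => by_contra fun h => absurd (hmin h hj.le) (not_le.2 hj)⟩
  obtain ⟨i, hi, hmin⟩ := hex
  have hik : i ≤ k := not_lt.1 fun hlt => hk (hmin k hlt)
  refine (lt_iff w a b).2 (Or.inr ⟨h, i, fun j hj => ?_, ?_⟩)
  · rw [hmin j hj, hb j (hj.le.trans hik)]
  · rw [hb i hik]; exact Nat.pos_of_ne_zero hi

theorem degree_binomial {ord : MonomialOrder (Fin N)} {a b : Fin N →₀ ℕ}
    (h : ord.toSyn b < ord.toSyn a) :
    ord.degree (monomial a 1 - monomial b 1 : MvPolynomial (Fin N) K) = a := by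
  classical
  rw [MonomialOrder.degree_sub_of_lt]
  · simp [MonomialOrder.degree_monomial]
  · simpa [MonomialOrder.degree_monomial] using h

theorem leadingCoeff_binomial {ord : MonomialOrder (Fin N)} {a b : Fin N →₀ ℕ}
    (h : ord.toSyn b < ord.toSyn a) :
    ord.leadingCoeff (monomial a 1 - monomial b 1 : MvPolynomial (Fin N) K) = 1 := by
  classical
  have hne : b ≠ a := by rintro rfl; exact lt_irrefl _ h
  rw [MonomialOrder.leadingCoeff, degree_binomial h, coeff_sub, coeff_monomial, coeff_monomial,
    if_pos rfl, if_neg hne, sub_zero]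

theorem leadingTerm_binomial {ord : MonomialOrder (Fin N)} {a b : Fin N →₀ ℕ}
    (h : ord.toSyn b < ord.toSyn a) :
    ord.leadingTerm (monomial a 1 - monomial b 1 : MvPolynomial (Fin N) K) = monomial a 1 := by
  rw [MonomialOrder.leadingTerm, degree_binomial h, leadingCoeff_binomial h]

theorem aeval_X_pow_monomial (a : Fin N →₀ ℕ) (c : K) :
    aeval (fun i => (Polynomial.X : Polynomial K) ^ w i) (monomial a c)
      = Polynomial.monomial (Finsupp.weight w a) c := by
  rw [aeval_monomial, Finsupp.weight_apply, Finsupp.prod, Finsupp.sum]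
  simp_rw [← pow_mul, smul_eq_mul, mul_comm (w _)]
  rw [Finset.prod_pow_eq_pow_sum, Polynomial.algebraMap_eq, Polynomial.C_mul_X_pow_eq_monomial]

/-- A nonzero element `f` of the kernel of `x_i ↦ t ^ {w_i}` cannot have a leading monomial that
is the least monomial of its weight: no other term of `f` could then cancel it in `K[t]`. -/
theorem exists_lt_degree_of_aeval_eq_zero {f : MvPolynomial (Fin N) K} (hf : f ≠ 0)
    (h : aeval (fun i => (Polynomial.X : Polynomial K) ^ w i) f = 0) :
    ∃ b, Finsupp.weight w b = Finsupp.weight w ((weightedGrevlex w hw).degree f) ∧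
      (weightedGrevlex w hw).toSyn b
        < (weightedGrevlex w hw).toSyn ((weightedGrevlex w hw).degree f) := by
  classical
  set ord := weightedGrevlex w hw
  by_contra! hmin
  have hc : ord.leadingCoeff f ≠ 0 := MonomialOrder.leadingCoeff_ne_zero_iff.2 hf
  apply hc
  rw [f.as_sum] at h
  have h' := congrArg (fun q => Polynomial.coeff q (Finsupp.weight w (ord.degree f))) h
  simp only [map_sum, aeval_X_pow_monomial, Polynomial.finsetSum_coeff, Polynomial.coeff_monomial,
    Polynomial.coeff_zero] at h'
  rw [Finset.sum_eq_single (ord.degree f)] at h'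
  · simpa using h'
  · intro b hb hne
    refine if_neg fun e => hne ?_
    exact ord.toSyn.injective (le_antisymm (ord.le_degree hb) (hmin b e))
  · intro hn
    rw [if_pos rfl]
    exact notMem_support_iff.1 hn

/-- A family of binomials `x^α - x^β` with `x^β < x^α` of equal weight is a Groebner basis of the
kernel of `x_i ↦ t ^ {w_i}` if the monomials divisible by none of the `x^α` have distinct weights.
For a monomial of least order in its weight is divisible by no `x^α`, since one could replace `x^α`
by `x^β`; so it is the only such monomial of its weight. -/
theorem isGroebnerBasis_of_weight_injOn {G : Set (MvPolynomial (Fin N) K)} (hfin : G.Finite)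
    (hG : ∀ f ∈ G, ∃ a b : Fin N →₀ ℕ, f = monomial a 1 - monomial b 1 ∧
      Finsupp.weight w b = Finsupp.weight w a ∧
      (weightedGrevlex w hw).toSyn b < (weightedGrevlex w hw).toSyn a)
    (hinj : ∀ c c' : Fin N →₀ ℕ,
      (∀ f ∈ G, ¬ (weightedGrevlex w hw).degree f ≤ c) →
      (∀ f ∈ G, ¬ (weightedGrevlex w hw).degree f ≤ c') →
      Finsupp.weight w c = Finsupp.weight w c' → c = c') :
    IsGroebnerBasis (weightedGrevlex w hw)
      (RingHom.ker (aeval (fun i => (Polynomial.X : Polynomial K) ^ w i) :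
        MvPolynomial (Fin N) K →ₐ[K] Polynomial K)) G := by
  classical
  set ord := weightedGrevlex w hw
  have hsub : G ⊆ (RingHom.ker (aeval (fun i => (Polynomial.X : Polynomial K) ^ w i) :
        MvPolynomial (Fin N) K →ₐ[K] Polynomial K) : Set (MvPolynomial (Fin N) K)) := by
    intro f hf
    obtain ⟨a, b, rfl, e, -⟩ := hG f hf
    rw [SetLike.mem_coe, RingHom.mem_ker, map_sub, aeval_X_pow_monomial, aeval_X_pow_monomial, e,
      sub_self]
  refine ⟨hfin, hsub, le_antisymm (Ideal.span_mono (Set.image_mono hsub)) ?_⟩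
  rw [Ideal.span_le]
  rintro _ ⟨f, hf, rfl⟩
  rw [SetLike.mem_coe, RingHom.mem_ker] at hf
  by_cases hf0 : f = 0
  · simp [hf0]
  by_cases hdiv : ∃ g ∈ G, ord.degree g ≤ ord.degree f
  · obtain ⟨g, hg, hle⟩ := hdiv
    obtain ⟨c, hc⟩ := exists_add_of_le hle
    obtain ⟨a, b, rfl, -, hlt⟩ := hG g hg
    have : ord.leadingTerm f
        = monomial c (ord.leadingCoeff f) * ord.leadingTerm (monomial a 1 - monomial b 1) := by
      rw [leadingTerm_binomial hlt, monomial_mul, mul_one, MonomialOrder.leadingTerm, hc,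
        degree_binomial hlt, add_comm]
    rw [SetLike.mem_coe, this]
    exact Ideal.mul_mem_left _ _ (Ideal.subset_span ⟨_, hg, rfl⟩)
  · exfalso
    push Not at hdiv
    -- the least monomial `c` of the weight of the leading monomial of `f`
    obtain ⟨c, hcw, hcmin⟩ := WellFounded.has_min (InvImage.wf ord.toSyn wellFounded_lt)
      {c | Finsupp.weight w c = Finsupp.weight w (ord.degree f)} ⟨_, rfl⟩
    have hcstd : ∀ g ∈ G, ¬ ord.degree g ≤ c := by
      intro g hg hle
      obtain ⟨c', hc'⟩ := exists_add_of_le hle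
      obtain ⟨a, b, rfl, e, hlt⟩ := hG g hg
      rw [degree_binomial hlt] at hc'
      subst hc'
      refine hcmin (b + c') ?_ ?_
      · rw [Set.mem_ofPred_eq, ← hcw, map_add, map_add, e]
      · simpa [InvImage] using hlt
    obtain rfl := hinj c _ hcstd hdiv hcw
    obtain ⟨b, hb1, hb2⟩ := exists_lt_degree_of_aeval_eq_zero (hw := hw) hf0 hf
    exact hcmin b hb1 hb2

end Criterion

namespace AlmostArith

open MvPolynomial

/-! ### The exponents of the generators -/

theorem ix_coe (p : ℕ) (l : Fin (p + 2)) : ix p l = l :=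
  Fin.ext (Nat.mod_eq_of_lt l.2)

theorem coe_ix {p k : ℕ} (hk : k ≤ p + 1) : (ix p k : ℕ) = k :=
  Nat.mod_eq_of_lt (by omega)

/-- The exponent vector of the variable `x_k`. -/
noncomputable def expX (p k : ℕ) : Fin (p + 2) →₀ ℕ := Finsupp.single (ix p k) 1

theorem expX_apply {p k : ℕ} (hk : k ≤ p + 1) (l : Fin (p + 2)) :
    expX p k l = if (l : ℕ) = k then 1 else 0 := by
  classical
  rw [expX, Finsupp.single_apply]
  refine if_congr ?_ rfl rfl
  rw [Fin.ext_iff, coe_ix hk, eq_comm]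

theorem weight_expX (p : ℕ) (m : Fin (p + 2) → ℕ) (k : ℕ) :
    Finsupp.weight m (expX p k) = m (ix p k) := by
  rw [expX, Finsupp.weight_single, one_smul]

theorem x_eq_monomial (p : ℕ) (K : Type*) [Field K] (k : ℕ) :
    x p K k = monomial (expX p k) 1 := rfl

theorem x_pow_eq_monomial (p : ℕ) (K : Type*) [Field K] (k a : ℕ) :
    x p K k ^ a = monomial (a • expX p k) 1 := by
  rw [x_eq_monomial, monomial_pow, one_pow]

/-- The exponent vector of `x_{r_t + i} x_p ^ {q_t}`, for `t ≥ 1`. -/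
noncomputable def headExp (p t i : ℕ) : Fin (p + 2) →₀ ℕ :=
  expX p (rem p t + i) + (quo p t).toNat • expX p p

/-- The exponent vector of the monomial `x_{r_t} x_p ^ {q_t}`, read as `1` for `t = 0`. -/
noncomputable def gExp (p t : ℕ) : Fin (p + 2) →₀ ℕ :=
  if t = 0 then 0 else headExp p t 0

section

variable {p : ℕ} {m : Fin (p + 2) → ℕ}

theorem gExp_of_pos {t : ℕ} (ht : 1 ≤ t) : gExp p t = headExp p t 0 :=
  if_neg (by omega)

theorem gMon_eq_monomial (p : ℕ) (K : Type*) [Field K] (t : ℕ) :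
    gMon p K t = monomial (gExp p t) 1 := by
  unfold gMon gExp
  split_ifs
  · rfl
  · rw [x_eq_monomial, x_pow_eq_monomial, monomial_mul, one_mul, headExp, add_zero]

theorem IsAlmostArithmetic.m_add (hm : IsAlmostArithmetic p m) {i j k l : ℕ} (hi : i ≤ p)
    (hj : j ≤ p) (hk : k ≤ p) (hl : l ≤ p) (h : i + j = k + l) :
    m (ix p i) + m (ix p j) = m (ix p k) + m (ix p l) := by
  obtain ⟨d, -, hd⟩ := hm.arith
  rw [hd i hi, hd j hj, hd k hk, hd l hl]
  have : (i + j) * d = (k + l) * d := by rw [h]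
  linarith

theorem IsAlmostArithmetic.weight_headExp (hm : IsAlmostArithmetic p m) {t i : ℕ} (ht : 1 ≤ t)
    (hi : i ≤ p - rem p t) :
    (Finsupp.weight m (headExp p t i) : ℤ) = g p m t + m (ix p i) - m (ix p 0) := by
  obtain ⟨-, h1, h2⟩ := quo_rem p hm.one_le_p t
  have := hm.m_add (i := rem p t + i) (j := 0) (k := rem p t) (l := i) (by omega) (by omega) h2
    (by omega) rfl
  zify at this
  rw [headExp, map_add, map_nsmul, weight_expX, weight_expX, smul_eq_mul]
  push_cast
  rw [Int.toNat_of_nonneg (quo_nonneg ht), g]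
  linear_combination this

theorem IsAlmostArithmetic.weight_gExp (hm : IsAlmostArithmetic p m) (t : ℕ) :
    (Finsupp.weight m (gExp p t) : ℤ) = g p m t := by
  unfold gExp
  split_ifs with h
  · rw [h, hm.g_zero, map_zero, Nat.cast_zero]
  · rw [hm.weight_headExp (by omega) (Nat.zero_le _)]; ring

/-- Every monomial `x_{r_t} x_p ^ {q_t}` with `t ≥ s` is divisible by some
`x_{r_s + i} x_p ^ {q_s}`. -/
theorem exists_headExp_le (hp : 1 ≤ p) {s t : ℕ} (hs : 1 ≤ s) (hst : s ≤ t) :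
    ∃ i ≤ p - rem p s, headExp p s i ≤ gExp p t := by
  obtain ⟨es, hs1, hs2⟩ := quo_rem p hp s
  obtain ⟨et, ht1, ht2⟩ := quo_rem p hp t
  have hq := quo_nonneg (p := p) hs
  rw [gExp_of_pos (hs.trans hst), headExp]
  rcases (quo_mono hp hst).eq_or_lt with h | h
  · refine ⟨rem p t - rem p s, by omega, ?_⟩
    rw [← h] at et
    rw [headExp, h, show rem p s + (rem p t - rem p s) = rem p t + 0 by omega]
  · refine ⟨p - rem p s, le_rfl, ?_⟩
    rw [headExp, show rem p s + (p - rem p s) = p by omega, ← succ_nsmul']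
    exact (nsmul_le_nsmul_left zero_le (by omega)).trans le_add_self

theorem headExp_apply (hp : 1 ≤ p) {t i : ℕ} (hi : i ≤ p - rem p t) (l : Fin (p + 2)) :
    headExp p t i l = (if (l : ℕ) = rem p t + i then 1 else 0)
      + (quo p t).toNat * if (l : ℕ) = p then 1 else 0 := by
  obtain ⟨-, h1, h2⟩ := quo_rem p hp t
  rw [headExp, Finsupp.add_apply, Finsupp.smul_apply, expX_apply (by omega),
    expX_apply (by omega), smul_eq_mul]

/-- A monomial divisible by no `x_i x_j` with `1 ≤ i ≤ j ≤ p - 1` has the form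
`x_0 ^ a x_{r_t} x_p ^ {q_t} x_n ^ b`. -/
theorem exists_eq_of_forall_not_expX_add_le (hp : 1 ≤ p) {c : Fin (p + 2) →₀ ℕ}
    (h : ∀ i j, 1 ≤ i → i ≤ j → j ≤ p - 1 → ¬ expX p i + expX p j ≤ c) :
    ∃ a t b : ℕ, c = a • expX p 0 + gExp p t + b • expX p (p + 1) := by
  obtain ⟨f, hf⟩ : ∃ f : ℕ → ℕ, ∀ l : Fin (p + 2), c l = f l :=
    ⟨fun k => c (ix p k), fun l => congrArg c (ix_coe p l).symm⟩
  have h' : ∀ i j, 1 ≤ i → i ≤ j → j ≤ p - 1 →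
      (i = j ∧ f i ≤ 1) ∨ (i ≠ j ∧ (f i = 0 ∨ f j = 0)) := by
    intro i j hi hij hj
    by_contra hc
    refine h i j hi hij hj (Finsupp.le_def.2 fun l => ?_)
    rw [Finsupp.add_apply, expX_apply (by omega), expX_apply (by omega), hf]
    split_ifs with h1 h2 h2
    · rw [h1]; omega
    · rw [h1]; omega
    · rw [h2]; omega
    · omega
  have happ : ∀ a b : ℕ, ∀ e : Fin (p + 2) →₀ ℕ,
      (∀ l, c l = a * (if (l : ℕ) = 0 then 1 else 0) + e l
        + b * (if (l : ℕ) = p + 1 then 1 else 0)) →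
      c = a • expX p 0 + e + b • expX p (p + 1) := by
    intro a b e he
    ext l
    rw [he, Finsupp.add_apply, Finsupp.add_apply, Finsupp.smul_apply, Finsupp.smul_apply,
      expX_apply (by omega), expX_apply (by omega), smul_eq_mul, smul_eq_mul]
  by_cases hk : ∃ k, 1 ≤ k ∧ k ≤ p - 1 ∧ f k ≠ 0
  · obtain ⟨k, hk1, hk2, hk0⟩ := hk
    have hk3 := h' k k hk1 le_rfl hk2
    obtain ⟨e1, e2⟩ := quo_eq_and_rem_eq hp (t := f p * p + k) (r := k) (q := f p)
      (by push_cast; ring) hk1 (by omega)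
    refine ⟨f 0, f p * p + k, f (p + 1), happ _ _ _ fun l => ?_⟩
    rw [gExp_of_pos (by omega), headExp_apply hp (Nat.zero_le _), e1, e2, Int.toNat_natCast, hf]
    have hl := l.2
    rcases (by omega : (l : ℕ) = 0 ∨ (l : ℕ) = p ∨ (l : ℕ) = p + 1 ∨ (l : ℕ) = k ∨
      (1 ≤ (l : ℕ) ∧ (l : ℕ) < k) ∨ (k < (l : ℕ) ∧ (l : ℕ) ≤ p - 1)) with e | e | e | e | e | e
    · rw [e]; simp [show ¬ 0 = k by omega, show ¬ 0 = p by omega]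
    · rw [e]; simp [show ¬ p = k by omega, show ¬ p = 0 by omega]
    · rw [e]; simp [show ¬ p + 1 = k by omega]
    · rw [e]; simp [show ¬ k = 0 by omega, show ¬ k = p by omega, show ¬ k = p + 1 by omega]
      omega
    · have := h' l k e.1 (by omega) hk2
      simp [show ¬ (l : ℕ) = 0 by omega, show ¬ (l : ℕ) = p by omega,
        show ¬ (l : ℕ) = p + 1 by omega, show ¬ (l : ℕ) = k by omega]
      omega
    · have := h' k l hk1 (by omega) e.2
      simp [show ¬ (l : ℕ) = 0 by omega, show ¬ (l : ℕ) = p by omega,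
        show ¬ (l : ℕ) = p + 1 by omega, show ¬ (l : ℕ) = k by omega]
      omega
  · push Not at hk
    have hg : ∀ l, gExp p (f p * p) l = f p * if (l : ℕ) = p then 1 else 0 := by
      intro l
      rcases Nat.eq_zero_or_pos (f p) with h0 | h0
      · simp [h0, gExp]
      · obtain ⟨e1, e2⟩ := quo_eq_and_rem_eq hp (t := f p * p) (r := p) (q := (f p : ℤ) - 1)
          (by push_cast; ring) hp le_rfl
        rw [gExp_of_pos (Nat.mul_pos h0 hp), headExp_apply hp (Nat.zero_le _), e1, e2,
          show ((f p : ℤ) - 1).toNat = f p - 1 by omega, add_zero]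
        split_ifs <;> omega
    refine ⟨f 0, f p * p, f (p + 1), happ _ _ _ fun l => ?_⟩
    rw [hf, hg]
    have hl := l.2
    rcases (by omega : (l : ℕ) = 0 ∨ (l : ℕ) = p ∨ (l : ℕ) = p + 1 ∨
      (1 ≤ (l : ℕ) ∧ (l : ℕ) ≤ p - 1)) with e | e | e | e
    · rw [e]; simp [show ¬ 0 = p by omega]
    · rw [e]; simp [show ¬ p = 0 by omega]
    · rw [e]; simp
    · simp [show ¬ (l : ℕ) = 0 by omega, show ¬ (l : ℕ) = p by omega,
        show ¬ (l : ℕ) = p + 1 by omega, hk l e.1 e.2]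

end

/-! ### The leading terms of the generators -/

section

variable {p : ℕ} {m : Fin (p + 2) → ℕ} {π : Params}

/-- `IsReduction m a b` says that `x^a - x^b` is homogeneous for the weights `m`, with leading
monomial `x^a`. -/
def IsReduction (m : Fin (p + 2) → ℕ) (a b : Fin (p + 2) →₀ ℕ) : Prop :=
  Finsupp.weight m b = Finsupp.weight m a ∧ WGrevlex.ofExp m b < WGrevlex.ofExp m a

theorem isReduction_of {a b : Fin (p + 2) →₀ ℕ}
    (h : (Finsupp.weight m a : ℤ) = Finsupp.weight m b) {k : ℕ} (hk : k ≤ p + 1)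
    (hb : b (ix p k) ≠ 0) (ha : ∀ l : Fin (p + 2), (l : ℕ) ≤ k → a l = 0) : IsReduction m a b := by
  have h' : Finsupp.weight m b = Finsupp.weight m a := by exact_mod_cast h.symm
  refine ⟨h', WGrevlex.lt_of_weight_eq h' (ix p k) hb fun l hl => ha l ?_⟩
  rwa [Fin.le_iff_val_le_val, coe_ix hk] at hl

theorem phi_eq (p : ℕ) (K : Type*) [Field K] (π : Params) (i : ℕ) :
    phi p K π i = monomial (headExp p π.u i) 1
      - monomial ((π.lam - 1) • expX p 0 + expX p i + π.w • expX p (p + 1)) 1 := by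
  simp only [phi, x_eq_monomial, monomial_pow, one_pow, monomial_mul, one_mul, headExp]

theorem psi_eq (p : ℕ) (K : Type*) [Field K] (π : Params) (j : ℕ) :
    psi p K π j = monomial (headExp p (π.u - π.z) j + (π.v - π.w) • expX p (p + 1)) 1
      - monomial ((π.nu - 1) • expX p 0 + expX p j) 1 := by
  simp only [psi, x_eq_monomial, monomial_pow, one_pow, monomial_mul, one_mul, headExp]

theorem theta_eq (p : ℕ) (K : Type*) [Field K] (π : Params) :
    theta p K π = monomial (π.v • expX p (p + 1)) 1
      - monomial (π.mu • expX p 0 + gExp p π.z) 1 := by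
  simp only [theta, x_pow_eq_monomial, gMon_eq_monomial, monomial_mul, one_mul]

/-- The exponent vector of the second term of `ξ_{i,j}`. -/
noncomputable def xiTailExp (p i j : ℕ) : Fin (p + 2) →₀ ℕ :=
  if i + j ≤ p then expX p 0 + expX p (i + j) else expX p (i + j - p) + expX p p

theorem xi_eq (p : ℕ) (K : Type*) [Field K] (i j : ℕ) :
    xi p K i j = monomial (expX p i + expX p j) 1 - monomial (xiTailExp p i j) 1 := by
  unfold xi xiTailExp
  split_ifs <;> simp only [x_eq_monomial, monomial_mul, one_mul]

theorem isReduction_phi (hm : IsAlmostArithmetic p m) (h : IsParams p m π) {i : ℕ}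
    (hi : i ≤ p - rem p π.u) :
    IsReduction m (headExp p π.u i)
      ((π.lam - 1) • expX p 0 + expX p i + π.w • expX p (p + 1)) := by
  have hp := hm.one_le_p
  obtain ⟨-, h1, h2⟩ := quo_rem p hp π.u
  refine isReduction_of (k := i) ?_ (by omega) ?_ fun l hl => ?_
  · rw [hm.weight_headExp (hm.one_le_u h.u_least) hi]
    simp only [map_add, map_nsmul, weight_expX, smul_eq_mul]
    push_cast [h.one_le_lam]
    linear_combination h.g_u
  · rw [Finsupp.add_apply, Finsupp.add_apply, expX_apply (by omega), if_pos (coe_ix (by omega))]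
    omega
  · rw [headExp_apply hp hi, if_neg (by omega), if_neg (by omega), mul_zero, add_zero]

theorem isReduction_psi (hm : IsAlmostArithmetic p m) (h : IsParams p m π) {j : ℕ}
    (hj : j ≤ p - rem p (π.u - π.z)) :
    IsReduction m (headExp p (π.u - π.z) j + (π.v - π.w) • expX p (p + 1))
      ((π.nu - 1) • expX p 0 + expX p j) := by
  have hp := hm.one_le_p
  have hw := h.w_lt
  have hz := h.z_lt
  have hnu := h.two_le_nu
  obtain ⟨-, h1, h2⟩ := quo_rem p hp (π.u - π.z)
  refine isReduction_of (k := j) ?_ (by omega) ?_ fun l hl => ?_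
  · rw [map_add, Nat.cast_add, hm.weight_headExp (by omega) hj]
    simp only [map_add, map_nsmul, weight_expX, smul_eq_mul]
    push_cast [hw.le, show 1 ≤ π.nu by omega]
    linear_combination h.g_u_sub_z
  · rw [Finsupp.add_apply, expX_apply (by omega), if_pos (coe_ix (by omega))]
    omega
  · rw [Finsupp.add_apply, Finsupp.smul_apply, headExp_apply hp hj, expX_apply (by omega),
      if_neg (by omega), if_neg (by omega), if_neg (by omega)]
    simp

theorem isReduction_theta (hm : IsAlmostArithmetic p m) (h : IsParams p m π) :
    IsReduction m (π.v • expX p (p + 1)) (π.mu • expX p 0 + gExp p π.z) := by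
  have hp := hm.one_le_p
  obtain ⟨-, h1, h2⟩ := quo_rem p hp π.z
  have hwt : (Finsupp.weight m (π.v • expX p (p + 1)) : ℤ)
      = Finsupp.weight m (π.mu • expX p 0 + gExp p π.z) := by
    rw [map_add, Nat.cast_add, hm.weight_gExp]
    simp only [map_nsmul, weight_expX, smul_eq_mul]
    push_cast
    exact h.v_mul
  have hl : ∀ k ≤ p, ∀ l : Fin (p + 2), (l : ℕ) ≤ k → (π.v • expX p (p + 1)) l = 0 := by
    intro k hk l hl
    rw [Finsupp.smul_apply, expX_apply le_rfl, if_neg (by omega), smul_zero]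
  rcases Nat.eq_zero_or_pos π.z with hz | hz
  · -- for `z = 0` the second term is `x_0 ^ μ`, and `μ > 0`
    refine isReduction_of (k := 0) hwt (by omega) ?_ (hl _ (by omega))
    have hmu : π.mu ≠ 0 := by
      intro hmu
      have e := h.v_mul
      rw [hmu, hz, hm.g_zero] at e
      have h3 := hm.zero_lt (p + 1)
      have h4 : (0 : ℤ) < π.v := by exact_mod_cast h.v_least.1.1
      have := mul_pos h4 h3
      simp at e
      omega
    rw [Finsupp.add_apply, Finsupp.smul_apply, expX_apply (by omega),
      if_pos (coe_ix (by omega)), smul_eq_mul]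
    omega
  · refine isReduction_of (k := rem p π.z) hwt (by omega) ?_ (hl _ h2)
    rw [Finsupp.add_apply, gExp_of_pos hz, headExp_apply hp (Nat.zero_le _), add_zero,
      if_pos (coe_ix (by omega))]
    omega

theorem isReduction_xi (hm : IsAlmostArithmetic p m) {i j : ℕ} (hi : 1 ≤ i) (hij : i ≤ j)
    (hj : j ≤ p - 1) : IsReduction m (expX p i + expX p j) (xiTailExp p i j) := by
  have hp := hm.one_le_p
  unfold xiTailExp
  split_ifs with h
  · refine isReduction_of (k := 0) ?_ (by omega) ?_ fun l hl => ?_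
    · simp only [map_add, weight_expX]
      exact_mod_cast hm.m_add (by omega) (by omega) (by omega) h (by omega)
    · rw [Finsupp.add_apply, expX_apply (by omega), if_pos (coe_ix (by omega))]
      omega
    · rw [Finsupp.add_apply, expX_apply (by omega), expX_apply (by omega), if_neg (by omega),
        if_neg (by omega)]
  · refine isReduction_of (k := i + j - p) ?_ (by omega) ?_ fun l hl => ?_
    · simp only [map_add, weight_expX]
      exact_mod_cast hm.m_add (by omega) (by omega) (by omega) le_rfl (by omega)
    · rw [Finsupp.add_apply, expX_apply (by omega), if_pos (coe_ix (by omega))]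
      omega
    · rw [Finsupp.add_apply, expX_apply (by omega), expX_apply (by omega), if_neg (by omega),
        if_neg (by omega)]

theorem exists_isReduction (hm : IsAlmostArithmetic p m) (h : IsParams p m π) (K : Type*) [Field K]
    {f : MvPolynomial (Fin (p + 2)) K} (hf : f ∈ patilSingh p K π) :
    ∃ a b, f = monomial a 1 - monomial b 1 ∧ IsReduction m a b := by
  rcases hf with ((⟨i, hi, rfl⟩ | rfl) | ⟨i, j, h1, h2, h3, rfl⟩) | ⟨j, hj, rfl⟩
  · exact ⟨_, _, phi_eq p K π i, isReduction_phi hm h hi⟩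
  · exact ⟨_, _, theta_eq p K π, isReduction_theta hm h⟩
  · exact ⟨_, _, xi_eq p K i j, isReduction_xi hm h1 h2 h3⟩
  · exact ⟨_, _, psi_eq p K π j, isReduction_psi hm h hj⟩

theorem patilSingh_finite (p : ℕ) (K : Type*) [Field K] (π : Params) :
    (patilSingh p K π).Finite := by
  refine (((?_ : Set.Finite _).union (Set.finite_singleton _)).union ?_).union ?_
  · refine ((Set.finite_Iic (p - rem p π.u)).image (phi p K π)).subset ?_
    rintro _ ⟨i, hi, rfl⟩
    exact ⟨i, hi, rfl⟩
  · refine (((Set.finite_Iic (p - 1)).prod (Set.finite_Iic (p - 1))).image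
      fun ij => xi p K ij.1 ij.2).subset ?_
    rintro _ ⟨i, j, -, hij, hj, rfl⟩
    exact ⟨(i, j), ⟨hij.trans hj, hj⟩, rfl⟩
  · refine ((Set.finite_Iic (p - rem p (π.u - π.z))).image (psi p K π)).subset ?_
    rintro _ ⟨i, hi, rfl⟩
    exact ⟨i, hi, rfl⟩

/-! ### The Groebner basis -/

/-- The shape of the monomials divisible by no leading monomial of a generator. -/
theorem exists_eq_of_forall_not_degree_le (hm : IsAlmostArithmetic p m) (h : IsParams p m π)
    (K : Type*) [Field K] {c : Fin (p + 2) →₀ ℕ}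
    (hc : ∀ f ∈ patilSingh p K π, ¬ (weightedGrevlex m hm.pos).degree f ≤ c) :
    ∃ a t b : ℕ, c = a • expX p 0 + gExp p t + b • expX p (p + 1) ∧ t < π.u ∧ b < π.v ∧
      (t < π.u - π.z ∨ b < π.v - π.w) := by
  have hp := hm.one_le_p
  have hred : ∀ a b, IsReduction m a b →
      (weightedGrevlex m hm.pos).degree (monomial a 1 - monomial b 1 : MvPolynomial _ K) = a :=
    fun a b hab => degree_binomial hab.2
  obtain ⟨a, t, b, rfl⟩ := exists_eq_of_forall_not_expX_add_le hp (c := c) fun i j h1 h2 h3 hle =>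
    hc _ (Or.inl (Or.inr ⟨i, j, h1, h2, h3, rfl⟩))
      (by rwa [xi_eq, hred _ _ (isReduction_xi hm h1 h2 h3)])
  refine ⟨a, t, b, rfl, ?_, ?_, ?_⟩
  · by_contra! hut
    obtain ⟨i, hi, hle⟩ := exists_headExp_le hp (hm.one_le_u h.u_least) hut
    refine hc _ (Or.inl (Or.inl (Or.inl ⟨i, hi, rfl⟩))) ?_
    rw [phi_eq, hred _ _ (isReduction_phi hm h hi)]
    exact hle.trans (le_add_self.trans le_self_add)
  · by_contra! hvb
    refine hc _ (Or.inl (Or.inl (Or.inr rfl))) ?_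
    rw [theta_eq, hred _ _ (isReduction_theta hm h)]
    exact (nsmul_le_nsmul_left zero_le hvb).trans le_add_self
  · by_contra! hlt
    have hz := h.z_lt
    obtain ⟨j, hj, hle⟩ := exists_headExp_le hp (by omega) hlt.1
    refine hc _ (Or.inr ⟨j, hj, rfl⟩) ?_
    rw [psi_eq, hred _ _ (isReduction_psi hm h hj)]
    exact add_le_add (hle.trans le_add_self) (nsmul_le_nsmul_left zero_le hlt.2)

theorem isGroebnerBasis_patilSingh (hm : IsAlmostArithmetic p m) (h : IsParams p m π)
    (K : Type*) [Field K] :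
    IsGroebnerBasis (weightedGrevlex m hm.pos) (curveIdeal p m K) (patilSingh p K π) := by
  refine isGroebnerBasis_of_weight_injOn (patilSingh_finite p K π)
    (fun f hf => exists_isReduction hm h K hf) fun c c' hc hc' e => ?_
  obtain ⟨a, t, b, rfl, ht, hb, hs⟩ := exists_eq_of_forall_not_degree_le hm h K hc
  obtain ⟨a', t', b', rfl, ht', hb', hs'⟩ := exists_eq_of_forall_not_degree_le hm h K hc'
  have hwt : ∀ a t b : ℕ,
      (Finsupp.weight m (a • expX p 0 + gExp p t + b • expX p (p + 1)) : ℤ)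
        = a * m (ix p 0) + g p m t + b * m (ix p (p + 1)) := by
    intro a t b
    simp only [map_add, map_nsmul, weight_expX, smul_eq_mul, Nat.cast_add, Nat.cast_mul,
      hm.weight_gExp]
  obtain ⟨rfl, rfl, rfl⟩ := IsParams.eq_of_weight_eq hm h ht ht' hb hb' hs hs'
    (by rw [← hwt, ← hwt, e])
  rfl

/-- If `1 ≤ z ≤ p` and `z = r_z < r`, then `q' = q` and `r' = r - z`, so that the leading monomial
of `ψ_z` is the product of that of `φ_0` and `x_n ^ (υ - w)`. -/
theorem not_isMinimalGroebnerBasis_patilSingh (hm : IsAlmostArithmetic p m) (h : IsParams p m π)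
    (K : Type*) [Field K] (hq : quo p π.z = 0) (hr : rem p π.z < rem p π.u) :
    ¬ IsMinimalGroebnerBasis (weightedGrevlex m hm.pos) (curveIdeal p m K)
      (patilSingh p K π) := by
  have hp := hm.one_le_p
  intro hmin
  obtain ⟨ez, hz1, hz2⟩ := quo_rem p hp π.z
  obtain ⟨eu, hu1, hu2⟩ := quo_rem p hp π.u
  have hzu := h.z_lt
  have hw := h.w_lt
  have hz : π.z = rem p π.z := by rw [hq] at ez; omega
  obtain ⟨e1, e2⟩ := quo_eq_and_rem_eq hp (t := π.u - π.z) (r := rem p π.u - π.z) (q := quo p π.u)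
    (by push_cast [hzu.le, show π.z ≤ rem p π.u by omega]; linarith) (by omega) (by omega)
  have hj : π.z ≤ p - rem p (π.u - π.z) := by omega
  have hhead : headExp p (π.u - π.z) π.z = headExp p π.u 0 := by
    rw [headExp, headExp, e1, e2, Nat.sub_add_cancel (by omega), add_zero]
  have hphi := leadingTerm_binomial (K := K) (ord := weightedGrevlex m hm.pos)
    (isReduction_phi hm h (i := 0) (Nat.zero_le _)).2
  have hpsi := leadingTerm_binomial (K := K) (ord := weightedGrevlex m hm.pos)
    (isReduction_psi hm h hj).2
  rw [← phi_eq] at hphi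
  rw [← psi_eq, hhead] at hpsi
  refine hmin.2.2 _ (Or.inr ⟨π.z, hj, rfl⟩) ?_
  have hmul : (monomial (headExp p π.u 0 + (π.v - π.w) • expX p (p + 1)) 1 :
      MvPolynomial (Fin (p + 2)) K)
      = monomial ((π.v - π.w) • expX p (p + 1)) 1 * monomial (headExp p π.u 0) 1 := by
    rw [monomial_mul, one_mul, add_comm (headExp p π.u 0)]
  rw [hpsi, hmul]
  refine Ideal.mul_mem_left _ _ (Ideal.subset_span
    ⟨phi p K π 0, ⟨Or.inl (Or.inl (Or.inl ⟨0, Nat.zero_le _, rfl⟩)), fun e => ?_⟩, hphi⟩)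
  -- `φ_0 ≠ ψ_z`, as their leading monomials differ by the factor `x_n ^ (υ - w) ≠ 1`
  rw [Set.mem_singleton_iff] at e
  rw [e, hpsi] at hphi
  have h3 := monomial_left_injective one_ne_zero hphi
  have h4 := DFunLike.congr_fun h3 (ix p (p + 1))
  rw [Finsupp.add_apply, Finsupp.smul_apply, expX_apply le_rfl, if_pos (coe_ix le_rfl),
    smul_eq_mul] at h4
  omega

end

/-! ### The example `(7, 8, 9, 11)` -/

/-- If all generators of a submonoid have size at least `7`, its elements of size less than `14` are
`0` and the generators. The size is a homomorphism to `ℤ`, to cover submonoids of `ℕ` and `ℤ`. -/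
theorem mem_closure_of_seven_le {A : Type*} [AddCommMonoid A] (φ : A →+ ℤ) {T : Set A}
    (hT : ∀ y ∈ T, 7 ≤ φ y) {y : A}
    (hy : y ∈ AddSubmonoid.closure T) : y = 0 ∨ y ∈ T ∨ 14 ≤ φ y := by
  induction hy using AddSubmonoid.closure_induction with
  | mem y hy => exact Or.inr (Or.inl hy)
  | zero => exact Or.inl rfl
  | add y y' _ _ h h' =>
    rcases h with rfl | h
    · rwa [zero_add]
    rcases h' with rfl | h'
    · rw [add_zero]; exact Or.inr h
    have h1 : 7 ≤ φ y := h.elim (hT y) fun h => by omega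
    have h2 : 7 ≤ φ y' := h'.elim (hT y') fun h => by omega
    exact Or.inr (Or.inr (by rw [map_add]; omega))

theorem isAlmostArithmetic_example : IsAlmostArithmetic 2 ![7, 8, 9, 11] where
  one_le_p := by norm_num
  pos := by decide
  arith := ⟨1, one_pos, by decide⟩
  gcd_eq_one := by decide
  minimal := by
    intro i hi
    have hlow : ∀ i : Fin 4, 7 ≤ (![7, 8, 9, 11] : Fin 4 → ℕ) i := by decide
    have hhigh : ∀ i : Fin 4, (![7, 8, 9, 11] : Fin 4 → ℕ) i < 14 := by decide
    have hinj : ∀ i j : Fin 4, (![7, 8, 9, 11] : Fin 4 → ℕ) i = ![7, 8, 9, 11] j → i = j := by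
      decide
    have h1 := hlow i
    have h2 := hhigh i
    have hT : ∀ y ∈ (![7, 8, 9, 11] : Fin 4 → ℕ) '' {j | j ≠ i},
        7 ≤ Nat.castAddMonoidHom ℤ y := by
      rintro _ ⟨j, -, rfl⟩
      rw [Nat.coe_castAddMonoidHom]
      exact_mod_cast hlow j
    rcases mem_closure_of_seven_le (Nat.castAddMonoidHom ℤ) hT hi with h | ⟨j, hj, h⟩ | h
    · omega
    · exact hj (hinj _ _ h)
    · rw [Nat.coe_castAddMonoidHom] at h
      omega

theorem isParams_example : IsParams 2 ![7, 8, 9, 11] ⟨4, 2, 1, 1, 1, 2, 4⟩ := by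
  have hm := isAlmostArithmetic_example
  have hG : ∀ y ∈ Gam 2 ![7, 8, 9, 11], y = 0 ∨ (7 ≤ y ∧ y ≠ 10) := by
    intro y hy
    have hT : ∀ k ≤ 3, 7 ≤ (![7, 8, 9, 11] : Fin 4 → ℕ) (ix 2 k) ∧
        (![7, 8, 9, 11] : Fin 4 → ℕ) (ix 2 k) ≠ 10 := by decide
    have hT' : ∀ y ∈ {y : ℤ | ∃ k ≤ 3, y = (![7, 8, 9, 11] : Fin 4 → ℕ) (ix 2 k)},
        7 ≤ AddMonoidHom.id ℤ y := by
      rintro _ ⟨k, hk, rfl⟩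
      have := hT k hk
      rw [AddMonoidHom.id_apply]
      omega
    rcases mem_closure_of_seven_le (AddMonoidHom.id ℤ) hT' hy with h | ⟨k, hk, rfl⟩ | h
    · exact Or.inl h
    · have := hT k hk
      omega
    · rw [AddMonoidHom.id_apply] at h
      omega
  have hG' : (11 : ℤ) ∉ Gam' 2 ![7, 8, 9, 11] := by
    intro hy
    have hT : ∀ k ≤ 2, 7 ≤ (![7, 8, 9, 11] : Fin 4 → ℕ) (ix 2 k) ∧
        (![7, 8, 9, 11] : Fin 4 → ℕ) (ix 2 k) ≠ 11 := by decide
    have hT' : ∀ y ∈ {y : ℤ | ∃ k ≤ 2, y = (![7, 8, 9, 11] : Fin 4 → ℕ) (ix 2 k)},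
        7 ≤ AddMonoidHom.id ℤ y := by
      rintro _ ⟨k, hk, rfl⟩
      have := hT k hk
      rw [AddMonoidHom.id_apply]
      omega
    rcases mem_closure_of_seven_le (AddMonoidHom.id ℤ) hT' hy with h | ⟨k, hk, h⟩ | h
    · omega
    · have := hT k hk
      omega
    · rw [AddMonoidHom.id_apply] at h
      omega
  have g0 : g 2 ![7, 8, 9, 11] 0 = 0 := by decide
  have g1 : g 2 ![7, 8, 9, 11] 1 = 8 := by decide
  have g2 : g 2 ![7, 8, 9, 11] 2 = 9 := by decide
  have g3 : g 2 ![7, 8, 9, 11] 3 = 17 := by decide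
  have g4 : g 2 ![7, 8, 9, 11] 4 = 18 := by decide
  have m0 : ((![7, 8, 9, 11] : Fin 4 → ℕ) (ix 2 0) : ℤ) = 7 := by decide
  have m3 : ((![7, 8, 9, 11] : Fin 4 → ℕ) (ix 2 (2 + 1)) : ℤ) = 11 := by decide
  refine ⟨⟨?_, ?_⟩, ⟨⟨one_le_two, ?_⟩, ?_⟩, ?_, ?_, le_rfl, ?_, ?_, ?_, ?_, ?_⟩
  · have := hm.not_mem_S (a := 1) (t := 0) (b := 1) le_rfl
    rw [g0, m0, m3] at this
    rw [Set.mem_ofPred_eq, g4]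
    exact this
  · intro t ht
    by_contra! hlt
    refine ht ⟨(hm.mem_Gam_iff _).2 ⟨0, t, 0, by simp⟩, fun h => ?_⟩
    have := hG _ h
    rw [m0] at this
    change t < 4 at hlt
    interval_cases t <;> omega
  · refine (hm.mem_Gam'_iff _).2 ⟨2, 1, ?_⟩
    rw [m0, m3, g1]; norm_num
  · rintro b ⟨hb1, hb⟩
    by_contra! hlt
    change b < 2 at hlt
    obtain rfl : b = 1 := by omega
    rw [m3] at hb
    exact hG' (by simpa using hb)
  · exact one_lt_two
  · norm_num
  · norm_num
  · rw [g4, m0, m3]; norm_num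
  · rw [g1, m0, m3]; norm_num
  · rw [show (4 : ℕ) - 1 = 3 from rfl, g3, m0, m3]; norm_num
  · decide

end AlmostArith

theorem theorem3p3 (K : Type*) [Field K] :
    (∀ (p : ℕ) (m : Fin (p + 2) → ℕ) (hm : AlmostArith.IsAlmostArithmetic p m),
      (∃! π : AlmostArith.Params, AlmostArith.IsParams p m π) ∧
      ∀ π : AlmostArith.Params, AlmostArith.IsParams p m π →
        IsGroebnerBasis (weightedGrevlex m hm.pos) (AlmostArith.curveIdeal p m K)
          (AlmostArith.patilSingh p K π) ∧
        (AlmostArith.quo p π.z = 0 → AlmostArith.rem p π.z < AlmostArith.rem p π.u →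
          ¬ IsMinimalGroebnerBasis (weightedGrevlex m hm.pos) (AlmostArith.curveIdeal p m K)
            (AlmostArith.patilSingh p K π))) ∧
    (∃ (p : ℕ) (m : Fin (p + 2) → ℕ) (hm : AlmostArith.IsAlmostArithmetic p m)
      (π : AlmostArith.Params), AlmostArith.IsParams p m π ∧
        AlmostArith.quo p π.z = 0 ∧ AlmostArith.rem p π.z < AlmostArith.rem p π.u ∧
        ¬ IsMinimalGroebnerBasis (weightedGrevlex m hm.pos) (AlmostArith.curveIdeal p m K)
          (AlmostArith.patilSingh p K π)) := by
  refine ⟨fun p m hm => ⟨?_, fun π h => ⟨AlmostArith.isGroebnerBasis_patilSingh hm h K,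
    AlmostArith.not_isMinimalGroebnerBasis_patilSingh hm h K⟩⟩, ?_⟩
  · obtain ⟨π, h⟩ := hm.exists_isParams
    exact ⟨π, h, fun π' h' => AlmostArith.IsParams.unique hm h' h⟩
  · have hq : AlmostArith.quo 2 1 = 0 := by decide
    have hr : AlmostArith.rem 2 1 < AlmostArith.rem 2 4 := by decide
    exact ⟨2, _, AlmostArith.isAlmostArithmetic_example, _, AlmostArith.isParams_example, hq, hr,
      AlmostArith.not_isMinimalGroebnerBasis_patilSingh AlmostArith.isAlmostArithmetic_example
        AlmostArith.isParams_example K hq hr⟩
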